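/- Let $\mathcal{D}\subseteq\mathbb{R}_{\ge 0}$ be a finite set with $0\in\mathcal{D}$, and let $\mathrm{M}=(M;\mathrm{d})$ be a countable Urysohn metric space with distance set $\mathcal{D}$; that is, $\mathrm{M}$ is a countable metric space whose set of distances is $\mathcal{D}$, every isometry of a finite subspace of $\mathrm{M}$ into $\mathrm{M}$ extends to an isometry of $\mathrm{M}$ onto $\mathrm{M}$, and every finite metric space with distances in $\mathcal{D}$ embeds isometrically into $\mathrm{M}$. For $r>0$ let $r^{\langle-\rangle}=\max([0,r)\cap\mathcal{D})$; for $r\in\mathcal D$ let $r^{\langle+\rangle}=\min\{s\in\mathcal{D}: s>r\}$ if $r<\max\mathcal{D}$ and $r^{\langle+\rangle}=r$ if $r=\max\mathcal{D}$. A set $\mathcal{B}=\{b_0<b_1<\dots<b_n\}\subseteq\mathcal{D}\setminus\{0\}$ is a block of $\mathcal{D}$ if $b_0>2\,b_0^{\langle-\rangle}$ and, for all $i<n$, $b_{i+1}=b_i^{\langle+\rangle}$ and $b_i+b_0\ge b_{i+1}$. The first block of $\mathcal{D}$ is the inclusion-maximal block $\mathcal{B}$ with $\min\mathcal{B}=\min(\mathcal{D}\setminus\{0\})$.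 A Katětov function of $\mathrm{M}$ is a function $\mathfrak{p}:F\to\mathcal{D}\setminus\{0\}$ with $F=\operatorname{dom}(\mathfrak{p})$ a finite subset of $M$, such that adding to $F$ one new point at distance $\mathfrak{p}(x)$ from each $x\in F$ gives a metric space. If $F\neq\emptyset$, its rank is $\operatorname{rank}(\mathfrak{p})=\min\{\mathfrak{p}(x):x\in F\}$. For $H\subseteq M$ put $\operatorname{orb}_H(\mathfrak{p})=\{y\in H\setminus F:\mathrm{d}(y,x)=\mathfrak{p}(x)\text{ for all }x\in F\}$. A copy of $\mathrm{M}$ in $\mathrm{M}$ is the image of an isometric embedding of $\mathrm{M}$ into $\mathrm{M}$. Let $\mathcal{B}$ be the first block of $\mathcal{D}$, let $r\in\mathcal{B}$ with $r>\min\mathcal{B}$, and let $S\subseteq M$. A Katětov function $\mathfrak{p}$ of $\mathrm{M}$ with $\operatorname{rank}(\mathfrak{p})=r$ is extendible into $S$ if for every copy $H$ of $\mathrm{M}$ in $\mathrm{M}$ with $\operatorname{dom}(\mathfrak{p})\subseteq H$ and every Katětov function $\mathfrak{p}'\supseteq\mathfrak{p}$ with $\operatorname{dom}(\mathfrak{p}')\subseteq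 H$ and $\operatorname{rank}(\mathfrak{p}')=r$ there are an isometric embedding $\alpha:H\to H$ with $\alpha(x)=x$ for all $x\in\operatorname{dom}(\mathfrak{p}')$ and a Katětov function $\mathfrak{g}\supseteq\mathfrak{p}'$ with $\operatorname{dom}(\mathfrak{g})\subseteq\alpha(H)$, $\operatorname{rank}(\mathfrak{g})=r^{\langle-\rangle}$ and $\operatorname{orb}_{\alpha(H)}(\mathfrak{g})\subseteq S$. Theorem. Let $\mathfrak{q}$ be a Katětov function of $\mathrm{M}$ with $\operatorname{rank}(\mathfrak{q})=r$ which is extendible into $S$. Then there is a copy $C$ of $\mathrm{M}$ in $\mathrm{M}$ with $\operatorname{dom}(\mathfrak{q})\subseteq C$ and $\operatorname{orb}_{C}(\mathfrak{q})\subseteq S$. -/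

import Mathlib

namespace UrysohnExt

/-- The metric space `M` is a countable Urysohn metric space with distance set exactly `D`:
it is homogeneous and every finite metric space with distances in `D` embeds into it. -/
structure IsCountableUrysohn (D : Set ℝ) (M : Type*) [MetricSpace M] : Prop where
  countable : Countable M
  dist_range : Set.range (fun p : M × M => dist p.1 p.2) = D
  homogeneous : ∀ (A : Finset M) (f : A → M), Isometry f →
    ∃ g : M ≃ᵢ M, ∀ a : A, g a = f a
  universal : ∀ (X : Type) [MetricSpace X] [Finite X], (∀ x y : X, dist x y ∈ D) →
    ∃ f : X → M, Isometry f

/-- `r^{⟨-⟩}`, the largest element of `D` below `r` (for `D` finite, `0 ∈ D` and `0 < r`). -/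
noncomputable def below (D : Set ℝ) (r : ℝ) : ℝ := sSup (Set.Ico 0 r ∩ D)

open Classical in
/-- `r^{⟨+⟩}`, the smallest element of `D` above `r` if `r < max D`, and `r` otherwise
(for `D` finite and nonempty). -/
noncomputable def above (D : Set ℝ) (r : ℝ) : ℝ :=
  if r < sSup D then sInf (Set.Ioc r (sSup D) ∩ D) else r

/-- `B` is a block of `D`: it has an increasing enumeration `b 0 < ⋯ < b n` by positive
consecutive elements of `D`, with gaps at most `b 0`, starting after a jump of `D`. -/
def IsBlock (D B : Set ℝ) : Prop :=
  B ⊆ D ∧ ∃ (n : ℕ) (b : Fin (n + 1) → ℝ), Set.range b = B ∧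
    0 < b 0 ∧
    (∀ i : Fin n, b i.castSucc < b i.succ) ∧
    below D (b 0) + below D (b 0) < b 0 ∧
    (∀ i : Fin n, b i.succ = above D (b i.castSucc)) ∧
    (∀ i : Fin n, b i.succ ≤ b i.castSucc + b 0)

/-- The first block of `D`: the (inclusion-maximal) block whose minimum is `min (D \ {0})`. -/
def IsFirstBlock (D B : Set ℝ) : Prop :=
  Maximal (fun B' : Set ℝ => IsBlock D B' ∧ ∃ m, IsLeast B' m ∧ IsLeast (D \ {0}) m) B

/-- A real-valued function on a finite subset `dom` of `M`. Only the values on `dom` matter: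
every notion below depends on `val` through its restriction to `dom` only. -/
structure TypeFn (M : Type*) where
  dom : Finset M
  val : M → ℝ

namespace TypeFn

variable {M : Type*}

/-- Inclusion `p ⊆ q` of partial functions. -/
def Sub (p q : TypeFn M) : Prop :=
  p.dom ⊆ q.dom ∧ ∀ x ∈ p.dom, q.val x = p.val x

/-- `rank p = r`: the minimum of the values of `p` is `r` (so the domain is nonempty). -/
def HasRank (p : TypeFn M) (r : ℝ) : Prop :=
  IsLeast (p.val '' (p.dom : Set M)) r

/-- The distance function of `Sp(p)`, on the domain of `p` together with the new point `none`
that represents `p` itself. -/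
def spDist [MetricSpace M] (p : TypeFn M) : Option p.dom → Option p.dom → ℝ
  | none, none => 0
  | none, some x => p.val x
  | some x, none => p.val x
  | some x, some y => dist (x : M) (y : M)

/-- `p` is a Katětov function (with respect to `D`): `Sp(p)` is a metric space with distances
in `D`. Since the new point differs from the points of the domain, the values are nonzero. -/
def IsKatetov [MetricSpace M] (D : Set ℝ) (p : TypeFn M) : Prop :=
  (∀ a b, p.spDist a b ∈ D) ∧
  (∀ a b, p.spDist a b = 0 ↔ a = b) ∧
  (∀ a b, p.spDist a b = p.spDist b a) ∧
  (∀ a b c, p.spDist a c ≤ p.spDist a b + p.spDist b c)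

/-- The orbit of `p` in the subspace `H`. -/
def orb [MetricSpace M] (H : Set M) (p : TypeFn M) : Set M :=
  {y | y ∈ H ∧ y ∉ p.dom ∧ ∀ x ∈ p.dom, dist y x = p.val x}

end TypeFn

/-- `C` is (the underlying set of) a copy of `M` in `M`. -/
def IsCopy {M : Type*} [MetricSpace M] (C : Set M) : Prop :=
  ∃ f : M → M, Isometry f ∧ Set.range f = C

/-- The Katětov function `p` of rank `r` is extendible into `S`. -/
def ExtendibleInto {M : Type*} [MetricSpace M] (D : Set ℝ) (r : ℝ) (S : Set M)
    (p : TypeFn M) : Prop :=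
  p.IsKatetov D ∧ p.HasRank r ∧
  ∀ H : Set M, IsCopy H → (p.dom : Set M) ⊆ H →
    ∀ p' : TypeFn M, p'.IsKatetov D → (p'.dom : Set M) ⊆ H → p.Sub p' → p'.HasRank r →
      ∃ α : H → H, Isometry α ∧ (∀ x : H, (x : M) ∈ p'.dom → α x = x) ∧
        ∃ g : TypeFn M, g.IsKatetov D ∧
          (g.dom : Set M) ⊆ Set.range (fun x : H => (α x : M)) ∧
          p'.Sub g ∧ g.HasRank (below D r) ∧
          g.orb (Set.range (fun x : H => (α x : M))) ⊆ S

end UrysohnExt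

namespace UrysohnExt

section DistanceSum

/-- The largest element of `D` that is at most `a + b`. -/
noncomputable def dsum (D : Set ℝ) (a b : ℝ) : ℝ := sSup {x ∈ D | x ≤ a + b}

variable {D : Set ℝ}

lemma dsum_comm (a b : ℝ) : dsum D a b = dsum D b a := by
  simp only [dsum, add_comm]

lemma dsum_mem_and_le (hD : D.Finite) (h0 : 0 ∈ D) {a b : ℝ} (ha : 0 ≤ a) (hb : 0 ≤ b) :
    dsum D a b ∈ D ∧ dsum D a b ≤ a + b :=
  Set.Nonempty.csSup_mem (s := {x ∈ D | x ≤ a + b}) ⟨0, h0, by positivity⟩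
    (hD.subset fun _ hx => hx.1)

lemma le_dsum (hD : D.Finite) {a b c : ℝ} (hc : c ∈ D) (h : c ≤ a + b) : c ≤ dsum D a b :=
  le_csSup (hD.subset fun _ hx => hx.1).bddAbove ⟨hc, h⟩

end DistanceSum

section Urysohn

variable {M : Type*} [MetricSpace M] {D : Set ℝ}

lemma IsCountableUrysohn.dist_mem (hM : IsCountableUrysohn D M) (x y : M) : dist x y ∈ D := by
  rw [← hM.dist_range]; exact ⟨(x, y), rfl⟩

lemma IsCountableUrysohn.nonneg (hM : IsCountableUrysohn D M) {a : ℝ} (ha : a ∈ D) : 0 ≤ a := by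
  rw [← hM.dist_range] at ha
  obtain ⟨p, rfl⟩ := ha
  exact dist_nonneg

/-- The extension property: every `D`-valued function on a finite subset that could be a
distance function to a point is realized. -/
lemma IsCountableUrysohn.exists_dist_eq (hM : IsCountableUrysohn D M) (h0 : 0 ∈ D)
    (A : Finset M) (p : M → ℝ)
    (hp : ∀ x ∈ A, p x ∈ D) (h1 : ∀ x ∈ A, ∀ y ∈ A, p x ≤ p y + dist y x)
    (h2 : ∀ x ∈ A, ∀ y ∈ A, dist x y ≤ p x + p y) :
    ∃ z, ∀ x ∈ A, dist z x = p x := by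
  by_cases hz : ∃ x ∈ A, p x = 0
  · obtain ⟨z, hzA, hz⟩ := hz
    refine ⟨z, fun x hx => le_antisymm ?_ ?_⟩
    · have := h2 z hzA x hx; linarith
    · have := h1 x hx z hzA; linarith
  push Not at hz
  let e : Fin A.card ≃ A := A.equivFin.symm
  let δ : Option (Fin A.card) → Option (Fin A.card) → ℝ := fun a b =>
    match a, b with
    | none, none => 0
    | none, some x => p (e x)
    | some x, none => p (e x)
    | some x, some y => dist (e x : M) (e y)
  have hpos : ∀ x : A, 0 < p x := fun x =>
    lt_of_le_of_ne (hM.nonneg (hp x x.2)) (Ne.symm (hz x x.2))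
  let _ : MetricSpace (Option (Fin A.card)) :=
    { dist := δ
      dist_self := by rintro (_ | x) <;> simp [δ]
      dist_comm := by rintro (_ | x) (_ | y) <;> simp [δ, dist_comm]
      dist_triangle := by
        rintro (_ | x) (_ | y) (_ | z) <;> simp only [δ]
        · simp
        · simp
        · have := hpos (e y); linarith
        · exact h1 _ (e z).2 _ (e y).2
        · simp
        · exact h2 _ (e x).2 _ (e z).2
        · have := h1 _ (e x).2 _ (e y).2
          rw [dist_comm] at this; linarith
        · exact dist_triangle _ _ _
      eq_of_dist_eq_zero := by
        rintro (_ | x) (_ | y) h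
        · rfl
        · exact absurd h (hpos (e y)).ne'
        · exact absurd h (hpos (e x)).ne'
        · have h' : dist (e x : M) (e y) = 0 := h
          rw [dist_eq_zero] at h'
          simpa using h' }
  obtain ⟨f, hf⟩ := hM.universal (Option (Fin A.card)) (by
    rintro (_ | x) (_ | y)
    · exact h0
    · exact hp _ (e y).2
    · exact hp _ (e x).2
    · exact hM.dist_mem _ _)
  obtain ⟨g, hg⟩ := hM.homogeneous A (fun a => f (some (e.symm a))) (by
    refine Isometry.of_dist_eq fun a b => ?_
    rw [hf.dist_eq]
    change dist (e (e.symm a) : M) (e (e.symm b)) = _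
    simp [Subtype.dist_eq])
  refine ⟨g.symm (f none), fun x hx => ?_⟩
  rw [← g.dist_eq, g.apply_symm_apply, hg ⟨x, hx⟩, hf.dist_eq]
  change p (e (e.symm ⟨x, hx⟩)) = p x
  simp

/-- Associativity of the truncated sum, also known as the four-values condition. -/
lemma IsCountableUrysohn.le_add_dsum (hM : IsCountableUrysohn D M) (hD : D.Finite) (h0 : 0 ∈ D)
    {a b c s t : ℝ} (ha : a ∈ D) (hb : b ∈ D) (hc : c ∈ D) (hs : s ∈ D) (ht : t ∈ D)
    (h1 : t ≤ a + b) (h2 : s ≤ t + c) : s ≤ a + dsum D b c := by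
  have h0a := hM.nonneg ha
  have h0b := hM.nonneg hb
  have h0c := hM.nonneg hc
  have hca : c ≤ dsum D b c := le_dsum hD hc (by linarith)
  have hba : b ≤ dsum D b c := le_dsum hD hb (by linarith)
  -- outside these trivial cases both triples below are metric triangles
  by_cases hsa : s ≤ a + b
  · linarith
  by_cases hsc : s ≤ a + c
  · linarith
  by_cases hsb : s ≤ b + c
  · have := le_dsum hD hs hsb; linarith
  push Not at hsa hsc hsb
  have hM' : Nonempty M := by
    rw [← hM.dist_range] at h0
    obtain ⟨p, -⟩ := h0
    exact ⟨p.1⟩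
  obtain ⟨x⟩ := hM'
  obtain ⟨z, hz⟩ := hM.exists_dist_eq h0 {x} (fun _ => t) (by simpa using ht) (by simp)
    (by simpa using hM.nonneg ht)
  have hzx : dist z x = t := hz x (by simp)
  by_cases hxz : z = x
  · subst hxz; rw [dist_self] at hzx; subst hzx; linarith
  have key : ∀ u v : ℝ, u ∈ D → v ∈ D → u ≤ v + t → v ≤ u + t → t ≤ u + v →
      ∃ y, dist y x = u ∧ dist y z = v := by
    intro u v hu hv huv hvu htuv
    classical
    have := hM.nonneg hu
    have := hM.nonneg hv
    obtain ⟨y, hy⟩ := hM.exists_dist_eq h0 {x, z} (fun w => if w = x then u else v)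
      (by simp [hxz, hu, hv])
      (by simp [hxz, hzx, dist_comm x z, huv, hvu])
      (by simp [dist_comm x z, add_comm v u, *])
    exact ⟨y, by simpa using hy x (by simp), by simpa [hxz] using hy z (by simp)⟩
  obtain ⟨y, hyx, hyz⟩ := key a b ha hb (by linarith) (by linarith) h1
  obtain ⟨w, hwx, hwz⟩ := key s c hs hc (by linarith) (by linarith) (by linarith)
  have hyw : dist y w ≤ dsum D b c := le_dsum hD (hM.dist_mem _ _) (by
    rw [← hyz, ← hwz, dist_comm w z]; exact dist_triangle _ _ _)
  have := dist_triangle w y x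
  rw [dist_comm w y] at this
  linarith

end Urysohn

section Amalgamation

variable {M : Type*} [MetricSpace M] {D : Set ℝ}

/-- `ρ` describes the distances between the points of `M` and those of `K` in a
pseudometric space with distances in `D` that is the union of `M` and `K`. -/
structure IsJoint (D : Set ℝ) (K : Finset M) (ρ : M → M → ℝ) : Prop where
  mem : ∀ w, ∀ k ∈ K, ρ w k ∈ D
  le_left : ∀ w w', ∀ k ∈ K, ρ w k ≤ dist w w' + ρ w' k
  dist_left : ∀ w w', ∀ k ∈ K, dist w w' ≤ ρ w k + ρ w' k
  le_right : ∀ w, ∀ k ∈ K, ∀ k' ∈ K, ρ w k' ≤ ρ w k + dist k k'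
  dist_right : ∀ w, ∀ k ∈ K, ∀ k' ∈ K, dist k k' ≤ ρ w k + ρ w k'

lemma IsCountableUrysohn.le_dsum_add_dsum (hM : IsCountableUrysohn D M) (hD : D.Finite)
    (h0 : 0 ∈ D) {a b c d s t u : ℝ} (ha : a ∈ D) (hb : b ∈ D) (hc : c ∈ D) (hd : d ∈ D)
    (hs : s ∈ D) (ht : t ∈ D) (hu : u ∈ D)
    (h1 : s ≤ a + t) (h2 : t ≤ u + d) (h3 : u ≤ b + c) :
    s ≤ dsum D a b + dsum D d c := by
  have hcd : dsum D c d ∈ D := (dsum_mem_and_le hD h0 (hM.nonneg hc) (hM.nonneg hd)).1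
  have h4 := hM.le_add_dsum hD h0 hb hc hd ht hu h3 h2
  have h5 := hM.le_add_dsum hD h0 hcd hb ha hs ht (by linarith) (by linarith : s ≤ t + a)
  rw [dsum_comm a b, dsum_comm d c]
  linarith

/-- The distance between `w` and `k` in the free amalgam over the common part `ι`. -/
noncomputable def amalgamDist {ι : Type*} (D : Set ℝ) (l : M → ι → ℝ) (R : ι → M → ℝ)
    (w k : M) : ℝ :=
  sInf (Set.range fun z => dsum D (l w z) (R z k))

section

variable {ι : Type*} {l : M → ι → ℝ} {R : ι → M → ℝ} {w k : M}

lemma exists_amalgamDist_eq [Nonempty ι] (hM : IsCountableUrysohn D M) (hD : D.Finite) (h0 : 0 ∈ D)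
    (hl : ∀ z, l w z ∈ D) (hR : ∀ z, R z k ∈ D) :
    ∃ z, amalgamDist D l R w k = dsum D (l w z) (R z k) := by
  obtain ⟨z, hz⟩ := Set.Nonempty.csInf_mem (Set.range_nonempty fun z => dsum D (l w z) (R z k))
    (hD.subset (by
      rintro _ ⟨z, rfl⟩
      exact (dsum_mem_and_le hD h0 (hM.nonneg (hl z)) (hM.nonneg (hR z))).1))
  exact ⟨z, hz.symm⟩

lemma amalgamDist_le (hM : IsCountableUrysohn D M) (hD : D.Finite) (h0 : 0 ∈ D)
    (hl : ∀ z, l w z ∈ D) (hR : ∀ z, R z k ∈ D) (z : ι) :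
    amalgamDist D l R w k ≤ dsum D (l w z) (R z k) :=
  csInf_le (hD.subset (by
      rintro _ ⟨z, rfl⟩
      exact (dsum_mem_and_le hD h0 (hM.nonneg (hl z)) (hM.nonneg (hR z))).1)).bddBelow ⟨z, rfl⟩

/-- Two pseudometric spaces `M` and `K` with a common part `ι` have a joint free amalgam. -/
lemma isJoint_amalgamDist [Nonempty ι] (hM : IsCountableUrysohn D M) (hD : D.Finite) (h0 : 0 ∈ D)
    {K : Finset M} (β : ι → ι → ℝ) (hβ : ∀ z z', β z z' ∈ D)
    (hl : ∀ w z, l w z ∈ D) (hR : ∀ z, ∀ k ∈ K, R z k ∈ D)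
    (l1 : ∀ w w' z, l w z ≤ dist w w' + l w' z)
    (l2 : ∀ w w' z, dist w w' ≤ l w z + l w' z)
    (l3 : ∀ w z z', l w z ≤ β z z' + l w z')
    (l4 : ∀ w z z', β z z' ≤ l w z + l w z')
    (R1 : ∀ z, ∀ k ∈ K, ∀ k' ∈ K, R z k' ≤ dist k k' + R z k)
    (R2 : ∀ z, ∀ k ∈ K, ∀ k' ∈ K, dist k k' ≤ R z k + R z k')
    (R3 : ∀ z z', ∀ k ∈ K, R z k ≤ β z z' + R z' k)
    (R4 : ∀ z z', ∀ k ∈ K, β z z' ≤ R z k + R z' k) :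
    IsJoint D K (amalgamDist D l R) where
  mem w k hk := by
    obtain ⟨z, hz⟩ := exists_amalgamDist_eq hM hD h0 (hl w) (fun z => hR z k hk)
    rw [hz]
    exact (dsum_mem_and_le hD h0 (hM.nonneg (hl w z)) (hM.nonneg (hR z k hk))).1
  le_left w w' k hk := by
    obtain ⟨z, hz⟩ := exists_amalgamDist_eq hM hD h0 (hl w') (fun z => hR z k hk)
    rw [hz]
    have h := dsum_mem_and_le hD h0 (hM.nonneg (hl w z)) (hM.nonneg (hR z k hk))
    exact (amalgamDist_le hM hD h0 (hl w) (fun z => hR z k hk) z).trans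
      (hM.le_add_dsum hD h0 (hM.dist_mem _ _) (hl _ _) (hR z k hk) h.1 (hl _ _) (l1 w w' z) h.2)
  dist_left w w' k hk := by
    obtain ⟨z, hz⟩ := exists_amalgamDist_eq hM hD h0 (hl w) (fun z => hR z k hk)
    obtain ⟨z', hz'⟩ := exists_amalgamDist_eq hM hD h0 (hl w') (fun z => hR z k hk)
    rw [hz, hz']
    exact hM.le_dsum_add_dsum hD h0 (hl _ _) (hR z k hk) (hR z' k hk) (hl _ _) (hM.dist_mem _ _)
      (hl w' z) (hβ z z') (l2 _ _ _) (l3 _ _ _) (R4 z z' k hk)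
  le_right w k hk k' hk' := by
    obtain ⟨z, hz⟩ := exists_amalgamDist_eq hM hD h0 (hl w) (fun z => hR z k hk)
    rw [hz, add_comm, dsum_comm]
    have h := dsum_mem_and_le hD h0 (hM.nonneg (hl w z)) (hM.nonneg (hR z k' hk'))
    exact (amalgamDist_le hM hD h0 (hl w) (fun z => hR z k' hk') z).trans
      (hM.le_add_dsum hD h0 (hM.dist_mem _ _) (hR z k hk) (hl w z) h.1 (hR z k' hk')
        (R1 z k hk k' hk') (h.2.trans_eq (add_comm _ _)))
  dist_right w k hk k' hk' := by
    obtain ⟨z, hz⟩ := exists_amalgamDist_eq hM hD h0 (hl w) (fun z => hR z k hk)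
    obtain ⟨z', hz'⟩ := exists_amalgamDist_eq hM hD h0 (hl w) (fun z => hR z k' hk')
    rw [hz, hz', dsum_comm, dsum_comm (l w z')]
    exact hM.le_dsum_add_dsum hD h0 (hR z k hk) (hl w z) (hl w z') (hR z' k' hk')
      (hM.dist_mem _ _) (hR z k' hk') (hβ z z') (R2 z k hk k' hk') (R3 z z' k' hk') (l4 _ _ _)

end

/-- If `ρ` is a joint distance of `M` and `K`, and `g` is a distance function over a larger set
that agrees with `ρ w` on `K` for all `w` in a set `O` of small diameter, then `ρ` extends to a
joint distance that agrees with `g` on `O`. -/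
lemma IsJoint.exists_extension (hM : IsCountableUrysohn D M) (hD : D.Finite) (h0 : 0 ∈ D)
    {K K' : Finset M} {ρ : M → M → ℝ} (hρ : IsJoint D K ρ) (hKK' : K ⊆ K')
    {O : Set M} (hO : O.Nonempty) {g : M → ℝ} (hgρ : ∀ w ∈ O, ∀ k ∈ K, g k = ρ w k)
    (hg : ∀ k ∈ K', g k ∈ D) (hg1 : ∀ k ∈ K', ∀ k' ∈ K', g k' ≤ dist k k' + g k)
    (hg2 : ∀ k ∈ K', ∀ k' ∈ K', dist k k' ≤ g k + g k')
    (hdiam : ∀ w ∈ O, ∀ w' ∈ O, ∀ k ∈ K', dist w w' ≤ g k + g k) :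
    ∃ ρ' : M → M → ℝ, IsJoint D K' ρ' ∧ (∀ w, ∀ k ∈ K, ρ' w k = ρ w k) ∧
      (∀ w ∈ O, ∀ k ∈ K', ρ' w k = g k) ∧
      (∀ f : M ≃ᵢ M, (∀ w, f w ∈ O ↔ w ∈ O) → (∀ w, ∀ k ∈ K, ρ (f w) k = ρ w k) →
        ∀ w, ∀ k ∈ K', ρ' (f w) k = ρ' w k) ∧
      (∀ w, ∀ k ∈ K', (∃ v ∈ O, ρ' w k = dsum D (dist w v) (g k)) ∨
        ∃ x ∈ K, ρ' w k = dsum D (ρ w x) (dist x k)) := by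
  obtain ⟨v₀, hv₀⟩ := hO
  let l : M → O ⊕ K → ℝ := fun w => Sum.elim (fun v => dist w v) (fun x => ρ w x)
  let R : O ⊕ K → M → ℝ := fun z k => Sum.elim (fun _ : O => g k) (fun x : K => dist (x : M) k) z
  let β : O ⊕ K → O ⊕ K → ℝ := fun z z' =>
    Sum.elim (fun v : O => l v z') (fun x : K => R z' x) z
  have : Nonempty (O ⊕ K) := ⟨Sum.inl ⟨v₀, hv₀⟩⟩
  have hl : ∀ w z, l w z ∈ D := by
    rintro w (v | x)
    · exact hM.dist_mem _ _
    · exact hρ.mem _ _ x.2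
  have hR : ∀ z, ∀ k ∈ K', R z k ∈ D := by
    rintro (v | x) k hk
    · exact hg k hk
    · exact hM.dist_mem _ _
  have hJ : IsJoint D K' (amalgamDist D l R) := by
    refine isJoint_amalgamDist hM hD h0 β ?_ hl hR ?_ ?_ ?_ ?_ ?_ ?_ ?_ ?_
    · rintro (v | x) z
      · exact hl _ _
      · exact hR _ _ (hKK' x.2)
    · rintro w w' (v | x)
      · exact dist_triangle _ _ _
      · exact hρ.le_left _ _ _ x.2
    · rintro w w' (v | x)
      · exact dist_triangle_right _ _ _
      · exact hρ.dist_left _ _ _ x.2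
    · rintro w (v | x) (v' | x')
      · simp only [l, β, Sum.elim_inl]
        rw [add_comm, dist_comm (v : M)]; exact dist_triangle _ _ _
      · simp only [l, β, Sum.elim_inl, Sum.elim_inr]
        have := hρ.dist_left w v x' x'.2; linarith
      · simp only [l, R, β, Sum.elim_inl, Sum.elim_inr]
        have := hρ.le_left w v' x x.2
        rw [hgρ v' v'.2 x x.2]; linarith
      · simp only [l, R, β, Sum.elim_inr]
        have := hρ.le_right w x' x'.2 x x.2; linarith
    · rintro w (v | x) (v' | x')
      · simp only [l, β, Sum.elim_inl]
        exact dist_triangle_left _ _ _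
      · simp only [l, β, Sum.elim_inl, Sum.elim_inr]
        rw [dist_comm w]; exact hρ.le_left _ _ _ x'.2
      · simp only [l, R, β, Sum.elim_inl, Sum.elim_inr]
        have := hρ.le_left v' w x x.2
        rw [hgρ v' v'.2 x x.2, dist_comm w]; linarith
      · simp only [l, R, β, Sum.elim_inr]
        have := hρ.dist_right w x' x'.2 x x.2; linarith
    · rintro (v | x) k hk k' hk'
      · exact hg1 _ hk _ hk'
      · simp only [R, Sum.elim_inr]
        have := dist_triangle (x : M) k k'; linarith
    · rintro (v | x) k hk k' hk'
      · exact hg2 _ hk _ hk'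
      · exact dist_triangle_left _ _ _
    · rintro (v | x) (v' | x') k hk
      · simp only [l, R, β, Sum.elim_inl]
        have := dist_nonneg (x := (v : M)) (y := v'); linarith
      · simp only [l, R, β, Sum.elim_inl, Sum.elim_inr]
        rw [← hgρ v v.2 x' x'.2, add_comm]
        exact hg1 _ (hKK' x'.2) _ hk
      · simp only [R, β, Sum.elim_inl, Sum.elim_inr]
        exact hg2 _ (hKK' x.2) _ hk
      · simp only [R, β, Sum.elim_inr]
        rw [dist_comm (x' : M) x]; exact dist_triangle _ _ _
    · rintro (v | x) (v' | x') k hk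
      · exact hdiam v v.2 v' v'.2 k hk
      · simp only [l, R, β, Sum.elim_inl, Sum.elim_inr]
        rw [← hgρ v v.2 x' x'.2, add_comm, dist_comm]
        exact hg1 _ hk _ (hKK' x'.2)
      · simp only [R, β, Sum.elim_inl, Sum.elim_inr]
        rw [dist_comm]
        exact hg1 _ hk _ (hKK' x.2)
      · simp only [R, β, Sum.elim_inr]
        rw [dist_comm (x' : M) x]; exact dist_triangle_right _ _ _
  have hcases : ∀ w, ∀ k ∈ K', (∃ v ∈ O, amalgamDist D l R w k = dsum D (dist w v) (g k)) ∨
        ∃ x ∈ K, amalgamDist D l R w k = dsum D (ρ w x) (dist x k) := by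
    intro w k hk
    obtain ⟨z | z, hz⟩ := exists_amalgamDist_eq hM hD h0 (hl w) (fun z => hR z k hk)
    · exact Or.inl ⟨z, z.2, hz⟩
    · exact Or.inr ⟨z, z.2, hz⟩
  refine ⟨amalgamDist D l R, hJ, ?_, ?_, ?_, hcases⟩
  · intro w k hk
    apply le_antisymm
    · refine (amalgamDist_le hM hD h0 (hl w) (fun z => hR z k (hKK' hk)) (Sum.inr ⟨k, hk⟩)).trans ?_
      have := (dsum_mem_and_le hD h0 (hM.nonneg (hρ.mem w k hk)) le_rfl).2
      simpa [l, R] using this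
    · obtain ⟨v, hv, h⟩ | ⟨x, hx, h⟩ := hcases w k (hKK' hk) <;> rw [h]
      · rw [hgρ v hv k hk]
        exact le_dsum hD (hρ.mem _ _ hk) (hρ.le_left _ _ _ hk)
      · exact le_dsum hD (hρ.mem _ _ hk) (hρ.le_right _ _ hx _ hk)
  · intro w hw k hk
    apply le_antisymm
    · refine (amalgamDist_le hM hD h0 (hl w) (fun z => hR z k hk) (Sum.inl ⟨w, hw⟩)).trans ?_
      have := (dsum_mem_and_le hD h0 le_rfl (hM.nonneg (hg k hk))).2
      simpa [l, R] using this
    · obtain ⟨v, hv, h⟩ | ⟨x, hx, h⟩ := hcases w k hk <;> rw [h]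
      · exact le_dsum hD (hg k hk) (by simp)
      · refine le_dsum hD (hg k hk) ?_
        rw [← hgρ w hw x hx, add_comm]
        exact hg1 _ (hKK' hx) _ hk
  · intro f hfO hfρ w k hk
    apply le_antisymm
    · obtain ⟨v, hv, h⟩ | ⟨x, hx, h⟩ := hcases w k hk <;> rw [h]
      · refine (amalgamDist_le hM hD h0 (hl (f w)) (fun z => hR z k hk)
          (Sum.inl ⟨f v, (hfO v).2 hv⟩)).trans_eq ?_
        simp [l, R, f.dist_eq]
      · refine (amalgamDist_le hM hD h0 (hl (f w)) (fun z => hR z k hk)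
          (Sum.inr ⟨x, hx⟩)).trans_eq ?_
        simp [l, R, hfρ w x hx]
    · obtain ⟨v, hv, h⟩ | ⟨x, hx, h⟩ := hcases (f w) k hk <;> rw [h]
      · refine (amalgamDist_le hM hD h0 (hl w) (fun z => hR z k hk)
          (Sum.inl ⟨f.symm v, (hfO _).1 (by simpa using hv)⟩)).trans_eq ?_
        simp only [l, R, Sum.elim_inl]
        rw [← f.dist_eq, f.apply_symm_apply]
      · refine (amalgamDist_le hM hD h0 (hl w) (fun z => hR z k hk)
          (Sum.inr ⟨x, hx⟩)).trans_eq ?_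
        simp [l, R, hfρ w x hx]

end Amalgamation

section Fusion

variable {M : Type*}

/-- A sequence of maps, each agreeing with the next on a longer initial segment of an
enumeration, has a limit. -/
lemma exists_fusion {x : ℕ → M} (hx : Function.Surjective x) (P : ℕ → (M → M) → Prop)
    {e₀ : M → M} (h₀ : P 0 e₀)
    (step : ∀ n e, P n e → ∃ e', P (n + 1) e' ∧ ∀ i < n, e' (x i) = e (x i)) :
    ∃ e : M → M, ∀ n, ∃ f, P n f ∧ ∀ i < n, e (x i) = f (x i) := by
  choose! s hs hs' using step
  let E : ℕ → M → M := fun n => Nat.rec e₀ (fun n e => s n e) n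
  have hE : ∀ n, P n (E n) := by
    intro n
    induction n with
    | zero => exact h₀
    | succ n ih => exact hs n _ ih
  have hstab : ∀ n i, i < n → ∀ k, E (n + k) (x i) = E n (x i) := by
    intro n i hi k
    induction k with
    | zero => rfl
    | succ k ih => rw [← ih]; exact hs' (n + k) _ (hE _) i (by omega)
  choose j hj using hx
  refine ⟨fun w => E (j w + 1) w, fun n => ⟨E n, hE n, fun i hi => ?_⟩⟩
  have h1 := hstab (j (x i) + 1) (j (x i)) (by omega) n
  have h2 := hstab n i hi (j (x i) + 1)
  rw [hj] at h1
  change E (j (x i) + 1) (x i) = E n (x i)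
  rw [← h1, ← h2, add_comm]

variable [MetricSpace M] {D : Set ℝ}

lemma IsCountableUrysohn.exists_enumeration (hM : IsCountableUrysohn D M) (h0 : 0 ∈ D) :
    ∃ x : ℕ → M, Function.Surjective x := by
  have := hM.countable
  have : Nonempty M := by
    rw [← hM.dist_range] at h0
    obtain ⟨p, -⟩ := h0
    exact ⟨p.1⟩
  exact exists_surjective_nat M

/-- A joint distance of `M` and a finite `K ⊆ M` is realized by an embedding of `M`. -/
lemma IsJoint.exists_isometry (hM : IsCountableUrysohn D M) (h0 : 0 ∈ D)
    {K : Finset M} {ρ : M → M → ℝ} (hρ : IsJoint D K ρ) :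
    ∃ e : M → M, Isometry e ∧ ∀ w, ∀ k ∈ K, dist (e w) k = ρ w k := by
  classical
  obtain ⟨x, hx⟩ := hM.exists_enumeration h0
  obtain ⟨e, he⟩ := exists_fusion hx (fun n e =>
      (∀ i < n, ∀ j < n, dist (e (x i)) (e (x j)) = dist (x i) (x j)) ∧
      ∀ i < n, ∀ k ∈ K, dist (e (x i)) k = ρ (x i) k) (e₀ := id) (by simp) (by
    rintro n e ⟨h1, h2⟩
    by_cases hn : ∃ i < n, x i = x n
    · obtain ⟨i, hi, hin⟩ := hn
      refine ⟨e, ⟨fun a ha b hb => ?_, fun a ha k hk => ?_⟩, fun _ _ => rfl⟩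
      · have key : ∀ a < n + 1, ∃ a' < n, x a' = x a := fun a ha => by
          rcases Nat.lt_succ_iff_lt_or_eq.1 ha with h | rfl
          · exact ⟨a, h, rfl⟩
          · exact ⟨i, hi, hin⟩
        obtain ⟨a', ha', haa⟩ := key a ha
        obtain ⟨b', hb', hbb⟩ := key b hb
        rw [← haa, ← hbb]; exact h1 _ ha' _ hb'
      · rcases Nat.lt_succ_iff_lt_or_eq.1 ha with h | rfl
        · exact h2 _ h _ hk
        · rw [← hin]; exact h2 _ hi _ hk
    have key : ∃ p : M → ℝ, (∀ k ∈ K, p k = ρ (x n) k) ∧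
        ∀ i < n, p (e (x i)) = dist (x n) (x i) := by
      refine ⟨fun u => if u ∈ K then ρ (x n) u else
        if h : ∃ i < n, e (x i) = u then dist (x n) (x h.choose) else 0, ?_, ?_⟩
      · intro k hk; simp [hk]
      · intro i hi
        by_cases hK : e (x i) ∈ K
        · simp only [hK, if_true]
          have h0' : ρ (x i) (e (x i)) = 0 := by rw [← h2 i hi _ hK, dist_self]
          have h3 := hρ.le_left (x n) (x i) _ hK
          have h4 := hρ.dist_left (x n) (x i) _ hK
          rw [h0'] at h3 h4
          linarith
        · simp only [hK, if_false]
          have h : ∃ j < n, e (x j) = e (x i) := ⟨i, hi, rfl⟩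
          rw [dif_pos h]
          have h5 := h1 _ h.choose_spec.1 i hi
          rw [h.choose_spec.2, dist_self] at h5
          rw [dist_eq_zero.1 h5.symm]
    obtain ⟨p, hpK, hpe⟩ := key
    obtain ⟨z, hz⟩ := hM.exists_dist_eq h0
      (K ∪ (Finset.range n).image fun i => e (x i)) p (by
        simp only [Finset.mem_union, Finset.mem_image, Finset.mem_range]
        rintro u (hu | ⟨i, hi, rfl⟩)
        · rw [hpK u hu]; exact hρ.mem _ _ hu
        · rw [hpe i hi]; exact hM.dist_mem _ _) (by
        simp only [Finset.mem_union, Finset.mem_image, Finset.mem_range]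
        rintro u (hu | ⟨i, hi, rfl⟩) v (hv | ⟨j, hj, rfl⟩)
        · rw [hpK u hu, hpK v hv]; exact hρ.le_right _ _ hv _ hu
        · rw [hpK u hu, hpe j hj, h2 j hj u hu]; exact hρ.le_left _ _ _ hu
        · rw [hpK v hv, hpe i hi, dist_comm v, h2 i hi v hv]; exact hρ.dist_left _ _ _ hv
        · rw [hpe i hi, hpe j hj, h1 j hj i hi]; exact dist_triangle _ _ _) (by
        simp only [Finset.mem_union, Finset.mem_image, Finset.mem_range]
        rintro u (hu | ⟨i, hi, rfl⟩) v (hv | ⟨j, hj, rfl⟩)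
        · rw [hpK u hu, hpK v hv]; exact hρ.dist_right _ _ hu _ hv
        · rw [hpK u hu, hpe j hj, dist_comm u, h2 j hj u hu]
          have := hρ.le_left (x j) (x n) _ hu
          rw [dist_comm (x j)] at this; linarith
        · rw [hpK v hv, hpe i hi, h2 i hi v hv, dist_comm (x n)]; exact hρ.le_left _ _ _ hv
        · rw [hpe i hi, hpe j hj, h1 i hi j hj]; exact dist_triangle_left _ _ _)
    simp only [Finset.mem_union, Finset.mem_image, Finset.mem_range] at hz
    have hzK : ∀ k ∈ K, dist z k = ρ (x n) k := fun k hk => by rw [hz k (Or.inl hk), hpK k hk]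
    have hze : ∀ i < n, dist z (e (x i)) = dist (x n) (x i) := fun i hi => by
      rw [hz _ (Or.inr ⟨i, hi, rfl⟩), hpe i hi]
    push Not at hn
    have hu : ∀ i < n, Function.update e (x n) z (x i) = e (x i) := fun i hi =>
      Function.update_of_ne (hn i hi) _ _
    refine ⟨Function.update e (x n) z, ⟨fun a ha b hb => ?_, fun a ha k hk => ?_⟩, hu⟩
    · rcases Nat.lt_succ_iff_lt_or_eq.1 ha with ha | rfl <;>
      rcases Nat.lt_succ_iff_lt_or_eq.1 hb with hb | hb
      · rw [hu a ha, hu b hb, h1 a ha b hb]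
      · subst hb
        rw [hu a ha, Function.update_self, dist_comm, hze a ha, dist_comm]
      · rw [hu b hb, Function.update_self, hze b hb]
      · subst hb; simp
    · rcases Nat.lt_succ_iff_lt_or_eq.1 ha with ha | rfl
      · rw [hu a ha, h2 a ha k hk]
      · rw [Function.update_self, hzK k hk])
  refine ⟨e, Isometry.of_dist_eq fun w w' => ?_, fun w k hk => ?_⟩
  · obtain ⟨i, rfl⟩ := hx w
    obtain ⟨j, rfl⟩ := hx w'
    obtain ⟨f, ⟨hf, -⟩, hef⟩ := he (i + j + 1)
    rw [hef i (by omega), hef j (by omega), hf i (by omega) j (by omega)]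
  · obtain ⟨i, rfl⟩ := hx w
    obtain ⟨f, ⟨-, hf⟩, hef⟩ := he (i + 1)
    rw [hef i (by omega), hf i (by omega) k hk]

/-- A joint distance of `M` and a finite subset `K` of a copy `H` of `M` is realized in `H`. -/
lemma IsJoint.exists_isometry_into_copy (hM : IsCountableUrysohn D M) (h0 : 0 ∈ D)
    {H : Set M} (hH : IsCopy H) {K : Finset M} (hK : (K : Set M) ⊆ H) {ρ : M → M → ℝ}
    (hρ : IsJoint D K ρ) :
    ∃ e : M → M, Isometry e ∧ Set.range e ⊆ H ∧ ∀ w, ∀ k ∈ K, dist (e w) k = ρ w k := by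
  classical
  obtain ⟨h, hh, rfl⟩ := hH
  have hmem : ∀ k ∈ K.preimage h hh.injective.injOn, h k ∈ K := fun k hk => by simpa using hk
  have hρ' : IsJoint D (K.preimage h hh.injective.injOn) (fun w k => ρ w (h k)) :=
    { mem := fun w k hk => hρ.mem _ _ (hmem k hk)
      le_left := fun w w' k hk => hρ.le_left _ _ _ (hmem k hk)
      dist_left := fun w w' k hk => hρ.dist_left _ _ _ (hmem k hk)
      le_right := fun w k hk k' hk' => by
        rw [← hh.dist_eq]; exact hρ.le_right _ _ (hmem k hk) _ (hmem k' hk')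
      dist_right := fun w k hk k' hk' => by
        rw [← hh.dist_eq]; exact hρ.dist_right _ _ (hmem k hk) _ (hmem k' hk') }
  obtain ⟨e, he, hek⟩ := hρ'.exists_isometry hM h0
  refine ⟨h ∘ e, hh.comp he, Set.range_comp_subset_range e h, fun w k hk => ?_⟩
  obtain ⟨k, rfl⟩ := hK hk
  rw [Function.comp_apply, hh.dist_eq, hek w k (by simpa using hk)]

end Fusion

section Katetov

variable {M : Type*} [MetricSpace M] {D : Set ℝ} {p : TypeFn M}

lemma TypeFn.IsKatetov.val_mem (hp : p.IsKatetov D) : ∀ k ∈ p.dom, p.val k ∈ D :=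
  fun k hk => hp.1 none (some ⟨k, hk⟩)

lemma TypeFn.IsKatetov.val_le (hp : p.IsKatetov D) :
    ∀ k ∈ p.dom, ∀ k' ∈ p.dom, p.val k' ≤ dist k k' + p.val k := fun k hk k' hk' => by
  have := hp.2.2.2 none (some ⟨k, hk⟩) (some ⟨k', hk'⟩)
  simp only [TypeFn.spDist] at this
  linarith

lemma TypeFn.IsKatetov.dist_le (hp : p.IsKatetov D) :
    ∀ k ∈ p.dom, ∀ k' ∈ p.dom, dist k k' ≤ p.val k + p.val k' := fun k hk k' hk' =>
  hp.2.2.2 (some ⟨k, hk⟩) none (some ⟨k', hk'⟩)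

lemma TypeFn.isKatetov_of_pos (hM : IsCountableUrysohn D M) (h0 : 0 ∈ D)
    (hpos : ∀ k ∈ p.dom, 0 < p.val k) (hmem : ∀ k ∈ p.dom, p.val k ∈ D)
    (h1 : ∀ k ∈ p.dom, ∀ k' ∈ p.dom, p.val k' ≤ p.val k + dist k k')
    (h2 : ∀ k ∈ p.dom, ∀ k' ∈ p.dom, dist k k' ≤ p.val k + p.val k') : p.IsKatetov D := by
  refine ⟨?_, ?_, ?_, ?_⟩
  · rintro (_ | x) (_ | y)
    · exact h0
    · exact hmem _ y.2
    · exact hmem _ x.2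
    · exact hM.dist_mem _ _
  · rintro (_ | x) (_ | y) <;> simp only [TypeFn.spDist]
    · simpa using (hpos _ y.2).ne'
    · simpa using (hpos _ x.2).ne'
    · rw [dist_eq_zero, Option.some_inj, Subtype.ext_iff]
  · rintro (_ | x) (_ | y) <;> simp [TypeFn.spDist, dist_comm]
  · rintro (_ | x) (_ | y) (_ | z) <;> simp only [TypeFn.spDist]
    · simp
    · simp
    · have := hpos _ y.2; linarith
    · exact h1 _ y.2 _ z.2
    · simp
    · exact h2 _ x.2 _ z.2
    · have := h1 _ y.2 _ x.2
      rw [dist_comm] at this; linarith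
    · exact dist_triangle _ _ _

end Katetov

section Block

variable {D B : Set ℝ} {m r : ℝ}

lemma below_mem (hD : D.Finite) (h0 : 0 ∈ D) (hr : 0 < r) : below D r ∈ D :=
  (Set.Nonempty.csSup_mem (s := Set.Ico 0 r ∩ D) ⟨0, ⟨le_rfl, hr⟩, h0⟩
    (hD.subset fun _ hx => hx.2)).2

lemma le_below (hD : D.Finite) {a : ℝ} (ha : a ∈ D) (h0 : 0 ≤ a) (har : a < r) :
    a ≤ below D r :=
  le_csSup (hD.subset fun _ hx => hx.2).bddAbove ⟨⟨h0, har⟩, ha⟩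

lemma IsFirstBlock.subset (hB : IsFirstBlock D B) : B ⊆ D := hB.prop.1.1

lemma IsFirstBlock.isLeast (hB : IsFirstBlock D B) (hm : IsLeast B m) : IsLeast (D \ {0}) m := by
  obtain ⟨m', h1, h2⟩ := hB.prop.2
  rwa [hm.unique h1]

lemma IsBlock.le_below_add (hD : D.Finite) (hB : IsBlock D B) (hm : IsLeast B m) (hr : r ∈ B)
    (hmr : m < r) : r ≤ below D r + m := by
  obtain ⟨hBD, n, b, rfl, hb0, hlt, -, -, hgap⟩ := hB
  have hmono : StrictMono b := Fin.strictMono_iff_lt_succ.2 hlt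
  have hm0 : m = b 0 := hm.unique
    ⟨⟨0, rfl⟩, by rintro _ ⟨i, rfl⟩; exact hmono.monotone (Fin.zero_le i)⟩
  obtain ⟨j, rfl⟩ := hr
  subst hm0
  obtain ⟨i, rfl⟩ := Fin.exists_succ_eq.2 (show j ≠ 0 by rintro rfl; exact lt_irrefl _ hmr)
  have h1 : b i.castSucc ≤ below D (b i.succ) :=
    le_below hD (hBD ⟨_, rfl⟩) (hb0.le.trans (hmono.monotone (Fin.zero_le _))) (hlt i)
  linarith [hgap i]

end Block

section Fixers

variable {M : Type*} [MetricSpace M] {D : Set ℝ}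

/-- `f` fixes every point of `F`. -/
def Fixes (F : Finset M) (f : M ≃ᵢ M) : Prop := ∀ x ∈ F, f x = x

lemma Fixes.symm {F : Finset M} {f : M ≃ᵢ M} (hf : Fixes F f) : Fixes F f.symm := fun x hx => by
  rw [f.symm_apply_eq, hf x hx]

lemma Fixes.trans {F : Finset M} {f g : M ≃ᵢ M} (hf : Fixes F f) (hg : Fixes F g) :
    Fixes F (f.trans g) := fun x hx => by
  rw [IsometryEquiv.trans_apply, hf x hx, hg x hx]

lemma Fixes.refl (F : Finset M) : Fixes F (IsometryEquiv.refl M) := fun _ _ => rfl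

lemma Fixes.dist_eq {F : Finset M} {f : M ≃ᵢ M} (hf : Fixes F f) {x : M} (hx : x ∈ F) (w : M) :
    dist (f w) x = dist w x := by
  conv_lhs => rw [← hf x hx]
  exact f.dist_eq _ _

/-- Points with equal distances to a finite set are conjugate over it. -/
lemma IsCountableUrysohn.exists_fixes (hM : IsCountableUrysohn D M) (F : Finset M) {w w' : M}
    (h : ∀ x ∈ F, dist w x = dist w' x) : ∃ f : M ≃ᵢ M, Fixes F f ∧ f w = w' := by
  classical
  have hw : w ∈ F → w' = w := fun hw => by
    have := h w hw
    rw [dist_self] at this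
    exact dist_eq_zero.1 this.symm
  obtain ⟨f, hf⟩ := hM.homogeneous (insert w F) (fun a => if (a : M) = w then w' else a) (by
    refine Isometry.of_dist_eq ?_
    rintro ⟨a, ha⟩ ⟨b, hb⟩
    rw [Finset.mem_insert] at ha hb
    simp only [Subtype.dist_eq]
    split_ifs with h1 h2 h2
    · rw [h1, h2, dist_self, dist_self]
    · rw [h1, h b (hb.resolve_left h2)]
    · rw [h2, dist_comm a, dist_comm a, h a (ha.resolve_left h1)]
    · rfl)
  refine ⟨f, fun x hx => ?_, ?_⟩
  · have := hf ⟨x, Finset.mem_insert_of_mem hx⟩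
    rw [this]
    split_ifs with h1
    · have h1' : x = w := h1
      subst h1'; exact hw hx
    · rfl
  · rw [hf ⟨w, Finset.mem_insert_self _ _⟩]; simp

/-- Finitely many points represent all orbits of the pointwise stabilizer of a finite set. -/
lemma IsCountableUrysohn.exists_finset_representatives (hM : IsCountableUrysohn D M)
    (hD : D.Finite) [Nonempty M] (F : Finset M) :
    ∃ R : Finset M, ∀ w, ∃ f : M ≃ᵢ M, Fixes F f ∧ f w ∈ R := by
  classical
  let t : M → F → ℝ := fun w x => dist w x
  have hfin : (Set.range t).Finite := (Set.Finite.pi fun _ : F => hD).subset (by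
    rintro _ ⟨w, rfl⟩ x -
    exact hM.dist_mem _ _)
  refine ⟨hfin.toFinset.image (Function.invFun t), fun w => ?_⟩
  have h : t (Function.invFun t (t w)) = t w := Function.invFun_eq ⟨w, rfl⟩
  obtain ⟨f, hf, hfw⟩ := hM.exists_fixes F (w := w) (w' := Function.invFun t (t w))
    (fun x hx => (congrFun h ⟨x, hx⟩).symm)
  exact ⟨f, hf, by rw [hfw]; exact Finset.mem_image_of_mem _ (by simp)⟩

end Fixers

section Construction

variable {M : Type*} [MetricSpace M] {D : Set ℝ} {r : ℝ} {S : Set M} {q : TypeFn M}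

/-- A copy `H` inside the range of `e` and a joint distance `ρ` of `M` and a finite `K ⊆ H`,
compatible with `e` on `F`, such that every point of `A` conjugate over `F'` to a point of `R`
is forced into `S`, while the other points of `A` keep distance at least `r` from `K`. -/
structure IsStage (D : Set ℝ) (r : ℝ) (S : Set M) (e : M → M) (F F' : Finset M) (A : Set M)
    (R : Finset M) (H : Set M) (K : Finset M) (ρ : M → M → ℝ) : Prop where
  copy : IsCopy H
  subset_range : H ⊆ Set.range e
  subset_copy : (K : Set M) ⊆ H
  map_mem : ∀ x ∈ F, e x ∈ K
  joint : IsJoint D K ρ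
  map_eq : ∀ w, ∀ x ∈ F, ρ w (e x) = dist w x
  invariant : ∀ f, Fixes F' f → ∀ w, ∀ k ∈ K, ρ (f w) k = ρ w k
  below_le : ∀ w ∈ A, ∀ k ∈ K, below D r ≤ ρ w k
  le_of_not : ∀ w ∈ A, (∀ f, Fixes F' f → f w ∉ R) → ∀ k ∈ K, r ≤ ρ w k
  forced : ∀ w ∈ A, (∃ f, Fixes F' f ∧ f w ∈ R) → ∀ u ∈ H, (∀ k ∈ K, dist u k = ρ w k) → u ∈ S

/-- The points realizing `q` at distance at least `r` from `F` but less than `r` from `y`. -/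
def newPoints (q : TypeFn M) (r : ℝ) (F : Finset M) (y : M) : Set M :=
  {w | w ∈ q.orb Set.univ ∧ (∀ x ∈ F, r ≤ dist w x) ∧ dist w y < r}

lemma exists_isStage [DecidableEq M] (hM : IsCountableUrysohn D M) (hD : D.Finite) (h0 : 0 ∈ D)
    (hr : 0 < r) (hbelow : 0 < below D r) (hgap : ∀ a ∈ D, 0 < a → r ≤ below D r + a) (hrD : r ∈ D)
    (hext : ExtendibleInto D r S q) {e : M → M} (he : Isometry e)
    (heq : ∀ x ∈ q.dom, e x = x) {F : Finset M} (hqF : q.dom ⊆ F) (y : M) (R : Finset M) :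
    ∃ H K ρ, IsStage D r S e F (insert y F) (newPoints q r F y) R H K ρ := by
  set A := newPoints q r F y with hA
  set F' := insert y F with hF'
  have hAfix : ∀ f, Fixes F' f → ∀ w, f w ∈ A → w ∈ A := by
    rintro f hf w ⟨⟨-, h1, h2⟩, h3, h4⟩
    have hFd : ∀ x ∈ F, dist (f w) x = dist w x := fun x hx =>
      hf.dist_eq (Finset.mem_insert_of_mem hx) w
    refine ⟨⟨trivial, fun h => h1 ?_, fun x hx => ?_⟩, fun x hx => ?_, ?_⟩
    · rwa [hf w (Finset.mem_insert_of_mem (hqF h))]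
    · rw [← hFd x (hqF hx), h2 x hx]
    · rw [← hFd x hx]; exact h3 x hx
    · rwa [← hf.dist_eq (Finset.mem_insert_self y F)]
  induction R using Finset.induction_on with
  | empty =>
    have hge : ∀ w ∈ A, ∀ k ∈ F.image e, r ≤ dist (e w) k := by
      intro w hw k hk
      obtain ⟨x, hx, rfl⟩ := Finset.mem_image.1 hk
      rw [he.dist_eq]
      exact hw.2.1 x hx
    refine ⟨Set.range e, F.image e, fun w k => dist (e w) k,
      ⟨e, he, rfl⟩, subset_rfl, by simp, fun x hx => Finset.mem_image_of_mem _ hx,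
      ⟨fun w k _ => hM.dist_mem _ _, fun w w' k _ => ?_, fun w w' k _ => ?_,
        fun w k _ k' _ => dist_triangle _ _ _, fun w k _ k' _ => dist_triangle_left _ _ _⟩,
      fun w x _ => he.dist_eq _ _, fun f hf w k hk => ?_, fun w hw k hk => ?_,
      fun w hw _ k hk => hge w hw k hk, by simp⟩
    · rw [← he.dist_eq w w']; exact dist_triangle _ _ _
    · rw [← he.dist_eq w w']; exact dist_triangle_right _ _ _
    · obtain ⟨x, hx, rfl⟩ := Finset.mem_image.1 hk
      simp only [he.dist_eq]
      exact hf.dist_eq (Finset.mem_insert_of_mem hx) w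
    · refine le_trans ?_ (hge w hw k hk)
      exact csSup_le ⟨0, ⟨le_rfl, hr⟩, h0⟩ fun a ha => ha.1.2.le
  | insert v R _ ih =>
    obtain ⟨H, K, ρ, hs⟩ := ih
    by_cases hv : v ∈ A ∧ ∀ f, Fixes F' f → f v ∉ R
    swap
    · refine ⟨H, K, ρ, { hs with le_of_not := ?_, forced := ?_ }⟩
      · intro w hw hwR
        exact hs.le_of_not w hw fun f hf h => hwR f hf (Finset.mem_insert_of_mem h)
      · rintro w hw ⟨f, hf, hfw⟩
        apply hs.forced w hw
        rcases Finset.mem_insert.1 hfw with rfl | h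
        · have hfA : f w ∈ A := hAfix f.symm hf.symm _ (by simpa using hw)
          simp only [not_and, not_forall, not_not] at hv
          obtain ⟨g, hg, hgR⟩ := hv hfA
          exact ⟨f.trans g, hf.trans hg, hgR⟩
        · exact ⟨f, hf, h⟩
    obtain ⟨hvA, hvR⟩ := hv
    have hqK : ∀ x ∈ q.dom, x ∈ K ∧ ρ v x = q.val x := fun x hx => by
      have h1 := hs.map_mem x (hqF hx)
      have h2 := hs.map_eq v x (hqF hx)
      rw [heq x hx] at h1 h2
      exact ⟨h1, h2.trans (hvA.1.2.2 x hx)⟩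
    have hvr := hs.le_of_not v hvA hvR
    obtain ⟨-, ⟨⟨x₀, hx₀, hx₀r⟩, -⟩, hext'⟩ := hext
    obtain ⟨α, hα, -, g, hgK, hgα, hsub, hgrank, hgS⟩ := hext' H hs.copy
      (fun x hx => hs.subset_copy (hqK x hx).1) ⟨K, ρ v⟩
      (TypeFn.isKatetov_of_pos hM h0 (fun k hk => hr.trans_le (hvr k hk)) (hs.joint.mem v)
        (hs.joint.le_right v) (hs.joint.dist_right v))
      hs.subset_copy ⟨fun x hx => (hqK x hx).1, fun x hx => (hqK x hx).2⟩
      ⟨⟨x₀, (hqK x₀ hx₀).1, (hqK x₀ hx₀).2.trans hx₀r⟩, by rintro _ ⟨k, hk, rfl⟩; exact hvr k hk⟩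
    set H' := Set.range (fun x : H => (α x : M)) with hH'
    have hH'H : H' ⊆ H := by rintro _ ⟨x, rfl⟩; exact (α x).2
    have hgbelow : ∀ k ∈ g.dom, below D r ≤ g.val k := fun k hk => hgrank.2 ⟨k, hk, rfl⟩
    let O : Set M := {w | ∃ f, Fixes F' f ∧ f v = w}
    have hOA : ∀ w ∈ O, w ∈ A := by
      rintro _ ⟨f, hf, rfl⟩
      exact hAfix f.symm hf.symm _ (by simpa using hvA)
    obtain ⟨ρ', hJ, hρ', hρ'O, hinv, hcases⟩ := hs.joint.exists_extension hM hD h0 hsub.1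
      (O := O) ⟨v, _, Fixes.refl F', rfl⟩ (g := g.val)
      (by
        rintro _ ⟨f, hf, rfl⟩ k hk
        rw [hs.invariant f hf v k hk]
        exact hsub.2 k hk)
      hgK.val_mem hgK.val_le hgK.dist_le
      (fun w hw w' hw' k hk => by
        have h1 := le_below hD (hM.dist_mem w y) dist_nonneg (hOA w hw).2.2
        have h2 := le_below hD (hM.dist_mem w' y) dist_nonneg (hOA w' hw').2.2
        have h3 := hgbelow k hk
        have h4 := dist_triangle_right w w' y
        linarith)
    refine ⟨H', g.dom, ρ', ?_, hH'H.trans hs.subset_range, hgα,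
      fun x hx => hsub.1 (hs.map_mem x hx), hJ, fun w x hx => ?_, fun f hf => ?_,
      fun w hw k hk => ?_, fun w hw hwR k hk => ?_, ?_⟩
    · obtain ⟨h, hh, hhH⟩ := hs.copy
      refine ⟨fun x => α ⟨h x, hhH ▸ ⟨x, rfl⟩⟩, ?_, ?_⟩
      · refine Isometry.of_dist_eq fun a b => ?_
        rw [← Subtype.dist_eq, hα.dist_eq, Subtype.dist_eq, hh.dist_eq]
      · ext u
        constructor
        · rintro ⟨x, rfl⟩; exact ⟨_, rfl⟩
        · rintro ⟨⟨z, hz⟩, rfl⟩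
          have hz' := hz
          rw [← hhH] at hz'
          obtain ⟨x, rfl⟩ := hz'
          exact ⟨x, rfl⟩
    · rw [hρ' w _ (hs.map_mem x hx), hs.map_eq w x hx]
    · refine hinv f (fun w => ⟨?_, ?_⟩) (hs.invariant f hf)
      · rintro ⟨f', hf', h⟩
        exact ⟨f'.trans f.symm, hf'.trans hf.symm, by simp [h]⟩
      · rintro ⟨f', hf', rfl⟩
        exact ⟨f'.trans f, hf'.trans hf, rfl⟩
    · have hb := below_mem hD h0 hr
      obtain ⟨u, -, h⟩ | ⟨x, hx, h⟩ := hcases w k hk <;> rw [h]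
      · exact le_dsum hD hb ((hgbelow k hk).trans (le_add_of_nonneg_left dist_nonneg))
      · exact le_dsum hD hb ((hs.below_le w hw x hx).trans (le_add_of_nonneg_right dist_nonneg))
    · obtain ⟨u, ⟨f, hf, rfl⟩, h⟩ | ⟨x, hx, h⟩ := hcases w k hk <;> rw [h]
      · have hne : w ≠ f v := by
          rintro rfl
          exact hwR f.symm hf.symm (by simp)
        have h1 := hgap _ (hM.dist_mem w (f v)) (dist_pos.2 hne)
        have h2 := hgbelow k hk
        exact le_dsum hD hrD (by linarith)
      · exact le_dsum hD hrD ((hs.le_of_not w hw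
          (fun f hf h => hwR f hf (Finset.mem_insert_of_mem h)) x hx).trans
            (le_add_of_nonneg_right dist_nonneg))
    · rintro w hw ⟨f, hf, hfw⟩ u hu huk
      rcases Finset.mem_insert.1 hfw with h | h
      · have hwO : w ∈ O := ⟨f.symm, hf.symm, by rw [← h]; simp⟩
        have huk' : ∀ k ∈ g.dom, dist u k = g.val k := fun k hk => by
          rw [huk k hk, hρ'O w hwO k hk]
        refine hgS ⟨hu, fun hug => ?_, huk'⟩
        have h1 := huk' u hug
        have h2 := hgbelow u hug
        rw [dist_self] at h1
        linarith
      · exact hs.forced w hw ⟨f, hf, h⟩ u (hH'H hu) fun k hk => by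
          rw [huk k (hsub.1 hk), hρ' w k hk]

/-- One more point can be added to the finite set near which the orbit of `q` is mapped
into `S`. -/
lemma exists_isometry_insert [DecidableEq M] (hM : IsCountableUrysohn D M) (hD : D.Finite)
    (h0 : 0 ∈ D)
    (hr : 0 < r) (hbelow : 0 < below D r) (hgap : ∀ a ∈ D, 0 < a → r ≤ below D r + a) (hrD : r ∈ D)
    (hext : ExtendibleInto D r S q) {e : M → M} (he : Isometry e)
    (heq : ∀ x ∈ q.dom, e x = x) {F : Finset M} (hqF : q.dom ⊆ F)
    (heS : ∀ w ∈ q.orb Set.univ, (∃ x ∈ F, dist w x < r) → e w ∈ S) (y : M) :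
    ∃ e' : M → M, Isometry e' ∧ (∀ x ∈ F, e' x = e x) ∧
      ∀ w ∈ q.orb Set.univ, (∃ x ∈ insert y F, dist w x < r) → e' w ∈ S := by
  have : Nonempty M := ⟨y⟩
  obtain ⟨R, hR⟩ := hM.exists_finset_representatives hD (insert y F)
  obtain ⟨H, K, ρ, hs⟩ := exists_isStage hM hD h0 hr hbelow hgap hrD hext he heq hqF y R
  obtain ⟨e', he', hrange, hdist⟩ :=
    hs.joint.exists_isometry_into_copy hM h0 hs.copy hs.subset_copy
  have hF : ∀ x ∈ F, e' x = e x := fun x hx => by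
    rw [← dist_eq_zero, hdist x _ (hs.map_mem x hx), hs.map_eq x x hx, dist_self]
  refine ⟨e', he', hF, fun w hw hwx => ?_⟩
  by_cases hwF : ∃ x ∈ F, dist w x < r
  · obtain ⟨w', hw'⟩ := hs.subset_range (hrange ⟨w, rfl⟩)
    have hd : ∀ x ∈ F, dist w' x = dist w x := fun x hx => by
      rw [← he.dist_eq, hw', ← hF x hx, he'.dist_eq]
    rw [← hw']
    refine heS w' ⟨trivial, fun h => ?_, fun x hx => ?_⟩ ?_
    · have := hd w' (hqF h)
      rw [dist_self] at this
      rw [← dist_eq_zero.1 this.symm] at h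
      exact hw.2.1 h
    · rw [hd x (hqF hx), hw.2.2 x hx]
    · obtain ⟨x, hx, hlt⟩ := hwF
      exact ⟨x, hx, by rwa [hd x hx]⟩
  · have hwA : w ∈ newPoints q r F y := by
      push Not at hwF
      refine ⟨hw, hwF, ?_⟩
      obtain ⟨x, hx, hlt⟩ := hwx
      rcases Finset.mem_insert.1 hx with rfl | hx
      · exact hlt
      · exact absurd hlt (not_lt.2 (hwF x hx))
    exact hs.forced w hwA (hR w) _ (hrange ⟨w, rfl⟩) (hdist w)

end Construction

end UrysohnExt

theorem theorem7p1 {M : Type*} [MetricSpace M] (D B : Set ℝ) (hD : D.Finite)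
    (hM : UrysohnExt.IsCountableUrysohn D M) (hB : UrysohnExt.IsFirstBlock D B)
    (m r : ℝ) (hm : IsLeast B m) (hr : r ∈ B) (hmr : m < r)
    (S : Set M) (q : UrysohnExt.TypeFn M)
    (hq : q.IsKatetov D) (hrank : q.HasRank r)
    (hext : UrysohnExt.ExtendibleInto D r S q) :
    ∃ C : Set M, UrysohnExt.IsCopy C ∧ (q.dom : Set M) ⊆ C ∧ q.orb C ⊆ S := by
  open UrysohnExt in
  classical
  have hrD : r ∈ D := hB.subset hr
  have h0 : (0 : ℝ) ∈ D := hq.1 none none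
  have hmD := hB.isLeast hm
  have hm0 : 0 < m := lt_of_le_of_ne (hM.nonneg hmD.1.1) (Ne.symm hmD.1.2)
  have hr0 : 0 < r := hm0.trans hmr
  have hbelow : 0 < below D r := hm0.trans_le (le_below hD hmD.1.1 hm0.le hmr)
  have hgap : ∀ a ∈ D, 0 < a → r ≤ below D r + a := fun a ha ha0 => by
    have h1 := hB.prop.1.le_below_add hD hm hr hmr
    have h2 := hmD.2 ⟨ha, ha0.ne'⟩
    linarith
  obtain ⟨x, hx⟩ := hM.exists_enumeration h0
  obtain ⟨e, he⟩ := exists_fusion hx (fun n e => Isometry e ∧ (∀ z ∈ q.dom, e z = z) ∧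
      ∀ w ∈ q.orb Set.univ, (∃ z ∈ q.dom ∪ (Finset.range n).image x, dist w z < r) → e w ∈ S)
    (e₀ := id) ⟨isometry_id, fun _ _ => rfl, by
      rintro w hw ⟨z, hz, hlt⟩
      have hz' : z ∈ q.dom := by simpa using hz
      rw [hw.2.2 z hz'] at hlt
      exact absurd hlt (not_lt.2 (hrank.2 ⟨z, hz', rfl⟩))⟩ (by
    rintro n e ⟨h1, h2, h3⟩
    obtain ⟨e', h1', h2', h3'⟩ := exists_isometry_insert hM hD h0 hr0 hbelow hgap hrD hext h1 h2
      Finset.subset_union_left h3 (x n)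
    refine ⟨e', ⟨h1', fun z hz => ?_, fun w hw hwz => h3' w hw ?_⟩, fun i hi => ?_⟩
    · rw [h2' z (Finset.mem_union_left _ hz), h2 z hz]
    · rwa [Finset.range_add_one, Finset.image_insert, Finset.union_insert] at hwz
    · exact h2' _ (Finset.mem_union_right _
        (Finset.mem_image_of_mem _ (Finset.mem_range.2 hi))))
  have hiso : Isometry e := Isometry.of_dist_eq fun w w' => by
    obtain ⟨i, rfl⟩ := hx w
    obtain ⟨j, rfl⟩ := hx w'
    obtain ⟨f, ⟨hf, -, -⟩, hef⟩ := he (i + j + 1)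
    rw [hef i (by omega), hef j (by omega), hf.dist_eq]
  have hfix : ∀ z ∈ q.dom, e z = z := fun z hz => by
    obtain ⟨i, rfl⟩ := hx z
    obtain ⟨f, ⟨-, hf, -⟩, hef⟩ := he (i + 1)
    rw [hef i (by omega), hf _ hz]
  refine ⟨Set.range e, ⟨e, hiso, rfl⟩, fun z hz => ⟨z, hfix z hz⟩, ?_⟩
  rintro _ ⟨⟨w, rfl⟩, hwq, hw⟩
  obtain ⟨i, rfl⟩ := hx w
  obtain ⟨f, ⟨-, -, hf⟩, hef⟩ := he (i + 1)
  rw [hef i (by omega)]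
  refine hf _ ⟨trivial, fun h => hwq ?_, fun z hz => ?_⟩ ⟨x i,
    Finset.mem_union_right _ (Finset.mem_image_of_mem _ (Finset.self_mem_range_succ i)),
    by simpa using hr0⟩
  · rwa [hfix _ h]
  · rw [← hw z hz, ← hiso.dist_eq, hfix z hz]
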